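/- Let $G=(V,E)$ be a finite simple graph with $n=|V|$ vertices and maximum degree $\Delta$, let $q\in\mathbb{N}$, $\beta\in[0,\infty]$ and $\lambda=e^{-\beta}$ (with $e^{-\infty}=0$ and $0^0=1$). The (antiferromagnetic) Potts model is the probability distribution $\pi$ on all colorings $X\in[q]^V$ (proper or not) with $\pi(X)\propto\lambda^{H(X)}$, where $H(X)$ is the number of monochromatic edges; for $\beta=\infty$ this is the uniform distribution on proper colorings. For $p\in(0,1]$, one transition of the distributed Metropolis–Hastings chain from a coloring $X$ is as follows. Independently, each vertex becomes active with probability $p$, and each active vertex $v$ proposes a uniformly random color $\sigma_v\in[q]$. Then, independently given the proposals, each edge $\{u,v\}$ is accepted with probability $A(X_u,\sigma_v)\,A(\sigma_u,X_v)\,A(\sigma_u,\sigma_v)$, where $A(x,y)=\lambda$ if $x=y$ and $A(x,y)=1$ otherwise, and every factor that involves the proposal of an inactive vertex is replaced by $1$. Finally, every active vertex $v$ all of whose incident edges are accepted changes its color to $\sigma_v$; all other vertices keep their color. (This is the chain of the Potts model, viewed as a pairwise Markov random field with vertex weights $1$ and edge weights $A$.) Write $P_p$ for its transition matrix. Theorem.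 For every real $\alpha>2$ there is $p_0\in(0,1]$ such that for every $p\in(0,p_0]$ there is a constant $C>0$, depending only on $\alpha$ and $p$, with the following property. For all $G$, $q$, $\beta\in[0,\infty]$ with $q\ge\alpha\Delta$, all $\delta\in(0,1)$, all initial colorings $X_0\in[q]^V$ and all integers $t\ge C\log(n/\delta)$, $$d_{\mathrm{TV}}\bigl(P_p^t(X_0,\cdot),\,\pi\bigr)\le\delta .$$ That is, the chain mixes in $O(\log(n/\delta))$ transitions. -/

import Mathlib

open scoped ENNReal

namespace DistMH

noncomputable section

/-- A pairwise Markov random field on the vertices `V` with alphabet `A`: vertex constraints `b v`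
and edge constraints. The constraint of the undirected edge `{u, v}` is stored once for each
orientation, `a u v x y` being its value when `u` is labeled `x` and `v` is labeled `y`; the function
`a u v` itself need not be symmetric. -/
structure PairwiseMRF (V A : Type*) where
  b : V → A → ℝ
  b_nonneg : ∀ v x, 0 ≤ b v x
  a : V → V → A → A → ℝ
  a_nonneg : ∀ u v x y, 0 ≤ a u v x y
  a_swap : ∀ u v x y, a u v x y = a v u y x

namespace PairwiseMRF

variable {V A : Type*} (M : PairwiseMRF V A)

/-- The largest value of the constraint of the edge `{u, v}` (the alphabet will be finite). -/
def maxA (u v : V) : ℝ := ⨆ z : A × A, M.a u v z.1 z.2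

/-- The fraction `A_e(x, y) / max A_e`. A label may be `none`, the missing proposal of an inactive
vertex; a fraction that is not well defined equals `1`. -/
def ratio (u v : V) : Option A → Option A → ℝ
  | some x, some y => if M.maxA u v = 0 then 1 else M.a u v x y / M.maxA u v
  | _, _ => 1

theorem maxA_comm (u v : V) : M.maxA u v = M.maxA v u := by
  unfold maxA
  rw [← (Equiv.prodComm A A).iSup_comp]
  exact iSup_congr fun z => M.a_swap u v z.2 z.1

theorem ratio_swap (u v : V) (x y : Option A) : M.ratio u v x y = M.ratio v u y x := by
  cases x <;> cases y <;> simp only [ratio]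
  rw [M.maxA_comm u v, M.a_swap u v]

/-- The probability that an edge is accepted, given the current labeling `X` and the
proposals `σ` (`σ v = none` when `v` is inactive). -/
def acceptProb (X : V → A) (σ : V → Option A) : Sym2 V → ℝ :=
  Sym2.lift ⟨fun u v =>
      M.ratio u v (some (X u)) (σ v) * M.ratio u v (σ u) (some (X v)) * M.ratio u v (σ u) (σ v),
    fun u v => by
      beta_reduce
      rw [M.ratio_swap u v, M.ratio_swap u v (σ u), M.ratio_swap u v (σ u)]
      ring⟩

variable [Fintype V] [DecidableEq V] [Fintype A] [DecidableEq A]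

/-- The probability of the proposals `σ`: independently, each vertex `v` is active with
probability `p`, and then proposes a label drawn proportionally to `b v`. -/
def proposalProb (p : ℝ) (σ : V → Option A) : ℝ :=
  ∏ v, match σ v with
    | none => 1 - p
    | some c => p * (M.b v c / ∑ x, M.b v x)

variable (G : SimpleGraph V) [DecidableRel G.Adj]

/-- The probability that `F` is exactly the set of accepted edges; edges are accepted
independently. -/
def acceptedSetProb (X : V → A) (σ : V → Option A) (F : Finset (Sym2 V)) : ℝ :=
  (∏ e ∈ F, M.acceptProb X σ e) * ∏ e ∈ G.edgeFinset \ F, (1 - M.acceptProb X σ e)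

/-- The new labeling: an active vertex takes its proposal if every incident edge is accepted. -/
def update (X : V → A) (σ : V → Option A) (F : Finset (Sym2 V)) : V → A := fun v =>
  match σ v with
  | none => X v
  | some c => if ∀ e ∈ G.edgeFinset, v ∈ e → e ∈ F then c else X v

/-- The transition matrix of the distributed Metropolis-Hastings chain on labelings `V → A`, with
activation probability `p`. -/
def transition (p : ℝ) : Matrix (V → A) (V → A) ℝ := fun X Y =>
  ∑ σ : V → Option A, M.proposalProb p σ *
    ∑ F ∈ G.edgeFinset.powerset,
      if update G X σ F = Y then M.acceptedSetProb G X σ F else 0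

end PairwiseMRF

/-- `exp (-β)` for an inverse temperature `β ∈ [0, ∞]`, with `exp (-∞) = 0`. -/
def boltzmann (β : ℝ≥0∞) : ℝ := if β = ⊤ then 0 else Real.exp (-β.toReal)

theorem boltzmann_nonneg (β : ℝ≥0∞) : 0 ≤ boltzmann β := by
  unfold boltzmann
  split_ifs
  · exact le_rfl
  · exact (Real.exp_pos _).le

/-- The partition function of the Hamiltonian `H` at inverse temperature `β`. The weight
`exp (-β) ^ H s` is `exp (-β * H s)` if `β` is finite, and its limit, the indicator of `H s = 0`, if
`β = ∞`. -/
def partitionFunction {S : Type*} [Fintype S] (H : S → ℕ) (β : ℝ≥0∞) : ℝ :=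
  ∑ s, boltzmann β ^ H s

/-- The Gibbs distribution of the Hamiltonian `H` at inverse temperature `β`. -/
def gibbs {S : Type*} [Fintype S] (H : S → ℕ) (β : ℝ≥0∞) (s : S) : ℝ :=
  boltzmann β ^ H s / partitionFunction H β

/-- The Potts Hamiltonian: the number of monochromatic edges. -/
def pottsHamiltonian {V : Type*} [Fintype V] [DecidableEq V] (G : SimpleGraph V)
    [DecidableRel G.Adj] (q : ℕ) (s : V → Fin q) : ℕ :=
  (G.edgeFinset.filter fun e => (e.map s).IsDiag).card

/-- The Potts model with `q` colors as a pairwise Markov random field: `b_v = 1`, and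
`A_e(x, y)` is `exp (-β)` if `x = y` and `1` otherwise. -/
def pottsMRF (V : Type*) (q : ℕ) (β : ℝ≥0∞) : PairwiseMRF V (Fin q) where
  b _ _ := 1
  b_nonneg _ _ := zero_le_one
  a _ _ x y := if x = y then boltzmann β else 1
  a_nonneg _ _ x y := by
    split_ifs
    · exact boltzmann_nonneg β
    · exact zero_le_one
  a_swap _ _ x y := by simp only [eq_comm]

/-- Total variation distance of two distributions on a finite set. -/
def tvDist {S : Type*} [Fintype S] (μ ν : S → ℝ) : ℝ := (∑ s, |μ s - ν s|) / 2

end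

end DistMH

set_option linter.unusedSectionVars false

namespace DistMH

noncomputable section

open Finset Matrix

/-! ### Indicators and product weights -/

/-! Write `λ = exp (-β)`. The proof is a path coupling in which the randomness of the edges is fixed
before the proposals are drawn. Each of the three factors of an acceptance probability becomes a
constraint that is in force with probability `1 - λ`, independently of the others, and an edge is
accepted iff no constraint in force is violated. The flags do not depend on the coloring, so two
copies of the chain can share them. Given the flags, the step is a deterministic function of
coloring and proposals.

Let `X` and `Y` differ only at `v`, with colors `a` and `b`. A neighbor `u` whose proposal is tested
against `v` is at risk from both `a` and `b`. If no other vertex it is tested against has color `a`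
or `b`, exchange `a` and `b` in its proposal for `Y`: then proposing `a` is rejected in both copies,
and only `b` is risky. Otherwise another tested vertex rejects one of the two colors in both copies.
Either way a single color is risky, so neighbors contribute at most `Δ p / q ≤ p / α` to first
order; without the exchange it would be twice that. Further disagreements away from `v` need two
adjacent vertices that both propose `a` or `b`, which costs `O(p²)`. The disagreement at `v`
disappears if `v` proposes one of the at least `q - Δ` colors absent around it, up to another
`O(p²)`. The expected distance is thus at most `1 - p (1 - 2 / α) + O(p²)`
(`proposalMean_disagreeBound_le`), uniformly in the graph, `q` and `β`.

Contraction is expressed through Lipschitz functions, and `tvDist_pow_le` turns it into mixing.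
Stationarity of the Gibbs distribution comes from an involution exchanging old colors and accepted
proposals. -/

/-- The real indicator of a proposition. -/
def ind (P : Prop) : ℝ := open Classical in if P then 1 else 0

theorem ind_of {P : Prop} (h : P) : ind P = 1 := if_pos h

theorem ind_of_not {P : Prop} (h : ¬P) : ind P = 0 := if_neg h

theorem ind_nonneg (P : Prop) : 0 ≤ ind P := by
  by_cases h : P
  · rw [ind_of h]; exact zero_le_one
  · rw [ind_of_not h]

theorem ind_le_one (P : Prop) : ind P ≤ 1 := by
  by_cases h : P
  · rw [ind_of h]
  · rw [ind_of_not h]; exact zero_le_one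

theorem ind_not (P : Prop) : ind (¬P) = 1 - ind P := by
  by_cases h : P
  · rw [ind_of h, ind_of_not (not_not.mpr h), sub_self]
  · rw [ind_of_not h, ind_of h, sub_zero]

theorem ind_and (P Q : Prop) : ind (P ∧ Q) = ind P * ind Q := by
  by_cases hP : P <;> by_cases hQ : Q <;> simp [ind, hP, hQ]

theorem ind_forall_mem {ι : Type*} (s : Finset ι) (P : ι → Prop) :
    ind (∀ i ∈ s, P i) = ∏ i ∈ s, ind (P i) := by
  by_cases h : ∀ i ∈ s, P i
  · rw [ind_of h, prod_eq_one fun i hi => ind_of (h i hi)]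
  · rw [ind_of_not h]
    push Not at h
    obtain ⟨i, hi, hP⟩ := h
    exact (prod_eq_zero hi (ind_of_not hP)).symm

section Product

variable {ι K : Type*} [Fintype ι] [DecidableEq ι] [Fintype K]

theorem sum_prod_weight_eq_one (w : ι → K → ℝ) (hw : ∀ i, ∑ k, w i k = 1) :
    ∑ σ : ι → K, ∏ i, w i (σ i) = 1 := by
  rw [← Fintype.prod_sum]
  exact prod_eq_one fun i _ => hw i

/-- Coordinates of a product distribution are independent. -/
theorem sum_prod_weight_mul_ind (w : ι → K → ℝ) (hw : ∀ i, ∑ k, w i k = 1) (s : Finset ι)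
    (P : ι → K → Prop) :
    ∑ σ : ι → K, (∏ i, w i (σ i)) * ind (∀ i ∈ s, P i (σ i)) =
      ∏ i ∈ s, ∑ k, w i k * ind (P i k) := by
  have key : ∀ σ : ι → K, (∏ i, w i (σ i)) * ind (∀ i ∈ s, P i (σ i)) =
      ∏ i, w i (σ i) * if i ∈ s then ind (P i (σ i)) else 1 := by
    intro σ
    rw [ind_forall_mem, prod_mul_distrib, Fintype.prod_ite_mem]
  simp_rw [key]
  rw [← Fintype.prod_sum (fun i k => w i k * if i ∈ s then ind (P i k) else 1),
    ← Fintype.prod_ite_mem s]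
  refine prod_congr rfl fun i _ => ?_
  split_ifs
  · rfl
  · simpa using hw i

theorem sum_prod_weight_mul_ind_eq (w : K → ℝ) (hw : ∑ k, w k = 1) (u : ι) (x : K) :
    ∑ σ : ι → K, (∏ i, w (σ i)) * ind (σ u = x) = w x := by
  have h := sum_prod_weight_mul_ind (fun _ => w) (fun _ : ι => hw) {u} (fun _ k => k = x)
  simp only [mem_singleton, forall_eq, prod_singleton] at h
  rw [h, sum_eq_single x (fun k _ hk => by rw [ind_of_not hk, mul_zero]) (by simp), ind_of rfl,
    mul_one]

theorem sum_prod_weight_mul_ind_eq_mul_ind_eq (w : K → ℝ) (hw : ∑ k, w k = 1) {u v : ι}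
    (huv : u ≠ v) (x y : K) :
    ∑ σ : ι → K, (∏ i, w (σ i)) * (ind (σ u = x) * ind (σ v = y)) = w x * w y := by
  have h := sum_prod_weight_mul_ind (fun _ => w) (fun _ : ι => hw) {u, v}
    (fun i k => k = if i = u then x else y)
  have one : ∀ z : K, ∑ k, w k * ind (k = z) = w z := fun z => by
    rw [sum_eq_single z (fun k _ hk => by rw [ind_of_not hk, mul_zero]) (by simp), ind_of rfl,
      mul_one]
  simp only [mem_insert, mem_singleton, forall_eq_or_imp, forall_eq, prod_pair huv, if_true,
    if_neg huv.symm, one, ind_and] at h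
  exact h

end Product

/-! ### Decomposition of the acceptance step into independent constraint flags -/

theorem boltzmann_le_one (β : ℝ≥0∞) : boltzmann β ≤ 1 := by
  unfold boltzmann
  split_ifs
  · exact zero_le_one
  · exact Real.exp_le_one_iff.mpr (neg_nonpos.mpr ENNReal.toReal_nonneg)

/-- The probability of the value `b` of a constraint flag. -/
def flagWeight (β : ℝ≥0∞) (b : Bool) : ℝ := if b then 1 - boltzmann β else boltzmann β

theorem flagWeight_nonneg (β : ℝ≥0∞) (b : Bool) : 0 ≤ flagWeight β b := by
  unfold flagWeight
  split_ifs
  · exact sub_nonneg.mpr (boltzmann_le_one β)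
  · exact boltzmann_nonneg β

theorem sum_flagWeight (β : ℝ≥0∞) : ∑ b, flagWeight β b = 1 := by
  simp [flagWeight]

theorem sum_flagWeight_mul_ind (β : ℝ≥0∞) (Q : Prop) [Decidable Q] :
    ∑ b, flagWeight β b * ind (b = true → ¬Q) = if Q then boltzmann β else 1 := by
  split_ifs with h <;> simp [flagWeight, ind, h]

section Flags

variable {V : Type*} [Fintype V] [DecidableEq V] {q : ℕ}

/-- Two colors are needed for the value 1 to occur. With a single color the maximum would be `λ`,
and normalizing would change the acceptance rule; this is why `2 ≤ q`, or the absence of edges, is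
assumed below. -/
theorem pottsMRF_maxA (hq : 2 ≤ q) (β : ℝ≥0∞) (u v : V) : (pottsMRF V q β).maxA u v = 1 := by
  have hle : ∀ z : Fin q × Fin q, (pottsMRF V q β).a u v z.1 z.2 ≤ 1 := fun z => by
    simp only [pottsMRF]
    split_ifs
    · exact boltzmann_le_one β
    · exact le_rfl
  have : Nonempty (Fin q × Fin q) := ⟨(⟨0, by omega⟩, ⟨1, by omega⟩)⟩
  refine le_antisymm (ciSup_le hle) ?_
  have h1 : (pottsMRF V q β).a u v ⟨0, by omega⟩ ⟨1, by omega⟩ = 1 := by simp [pottsMRF]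
  rw [← h1]
  exact le_ciSup (f := fun z : Fin q × Fin q => (pottsMRF V q β).a u v z.1 z.2)
    ⟨1, by rintro _ ⟨z, rfl⟩; exact hle z⟩ (⟨0, by omega⟩, ⟨1, by omega⟩)

theorem pottsMRF_ratio (hq : 2 ≤ q) (β : ℝ≥0∞) (u v : V) (x y : Option (Fin q)) :
    (pottsMRF V q β).ratio u v x y = if x = y ∧ x ≠ none then boltzmann β else 1 := by
  cases x <;> cases y <;> simp [PairwiseMRF.ratio, pottsMRF_maxA hq]
  simp [pottsMRF]

/-- The edge is accepted under hard constraints, if `k` flags the constraints that are in force: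
`k (some u)` for the proposal at `u` and the current color at the other end, and `k none` for the
two proposals. -/
def Sat (X : V → Fin q) (σ : V → Option (Fin q)) (k : Option V → Bool) : Sym2 V → Prop :=
  Sym2.lift ⟨fun u v => (k (some u) = true → ¬(σ u = some (X v))) ∧
      (k (some v) = true → ¬(σ v = some (X u))) ∧
      (k none = true → ¬(σ u = σ v ∧ σ u ≠ none)), fun u v => by
    beta_reduce
    refine propext ?_
    rw [← and_assoc, ← and_assoc, and_comm (a := k (some u) = true → _)]
    refine and_congr Iff.rfl (imp_congr Iff.rfl (not_congr ?_))
    constructor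
    · rintro ⟨h, h'⟩; exact ⟨h.symm, h ▸ h'⟩
    · rintro ⟨h, h'⟩; exact ⟨h.symm, h ▸ h'⟩⟩

/-- A violated constraint is harmless exactly when its flag is off, which has probability `λ`. The
two ends are distinct, so the three constraints use three different, hence independent, flags. -/
theorem sum_flagWeight_mul_ind_sat (hq : 2 ≤ q) (β : ℝ≥0∞) (X : V → Fin q)
    (σ : V → Option (Fin q)) (e : Sym2 V) (he : ¬e.IsDiag) :
    ∑ k : Option V → Bool, (∏ i, flagWeight β (k i)) * ind (Sat X σ k e) =
      (pottsMRF V q β).acceptProb X σ e := by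
  induction e with | _ u v
  have huv : u ≠ v := he
  have h := sum_prod_weight_mul_ind (fun _ => flagWeight β)
    (fun _ : Option V => sum_flagWeight β) {some u, some v, none}
    (fun i b => b = true → ¬(match i with
      | none => σ u = σ v ∧ σ u ≠ none
      | some x => if x = u then σ u = some (X v) else σ v = some (X u)))
  classical
  simp only [mem_insert, mem_singleton, forall_eq_or_imp, forall_eq, if_true,
    if_neg huv.symm] at h
  rw [prod_insert (by simp [huv]), prod_pair (by simp)] at h
  simp only [if_true, if_neg huv.symm, sum_flagWeight_mul_ind] at h
  refine Eq.trans ?_ (h.trans ?_)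
  · rfl
  · simp only [PairwiseMRF.acceptProb, Sym2.lift_mk, pottsMRF_ratio hq]
    have h1 : (some (X u) = σ v ∧ some (X u) ≠ none) ↔ σ v = some (X u) := by
      simp [eq_comm]
    have h2 : (σ u = some (X v) ∧ σ u ≠ none) ↔ σ u = some (X v) := by
      constructor
      · exact And.left
      · intro h; exact ⟨h, by simp [h]⟩
    simp only [h1, h2]
    ring

variable (G : SimpleGraph V) [DecidableRel G.Adj]

/-- The probability of the constraint flags `κ` of all edges. -/
def flagsWeight (β : ℝ≥0∞) (κ : Sym2 V → Option V → Bool) : ℝ := ∏ e, ∏ i, flagWeight β (κ e i)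

theorem flagsWeight_nonneg (β : ℝ≥0∞) (κ : Sym2 V → Option V → Bool) : 0 ≤ flagsWeight β κ :=
  prod_nonneg fun _ _ => prod_nonneg fun _ _ => flagWeight_nonneg _ _

theorem sum_flagsWeight (β : ℝ≥0∞) :
    ∑ κ : Sym2 V → Option V → Bool, flagsWeight β κ = 1 :=
  sum_prod_weight_eq_one (fun (_ : Sym2 V) (k : Option V → Bool) => ∏ i, flagWeight β (k i))
    fun _ => sum_prod_weight_eq_one (fun _ => flagWeight β) fun _ => sum_flagWeight β

/-- The edges accepted under the flagged constraints. -/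
def satEdges (X : V → Fin q) (σ : V → Option (Fin q)) (κ : Sym2 V → Option V → Bool) :
    Finset (Sym2 V) :=
  open Classical in G.edgeFinset.filter fun e => Sat X σ (κ e) e

/-- Different edges use disjoint families of flags, so their acceptances are independent; flags of
pairs that are not edges sum out to 1. -/
theorem acceptedSetProb_eq_sum_flags (hq : 2 ≤ q ∨ G.edgeFinset = ∅) (β : ℝ≥0∞) (X : V → Fin q)
    (σ : V → Option (Fin q)) (F : Finset (Sym2 V)) (hF : F ⊆ G.edgeFinset) :
    (pottsMRF V q β).acceptedSetProb G X σ F =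
      ∑ κ, flagsWeight β κ * ind (satEdges G X σ κ = F) := by
  have h := sum_prod_weight_mul_ind (fun (_ : Sym2 V) (k : Option V → Bool) =>
      ∏ i, flagWeight β (k i)) (fun _ => sum_prod_weight_eq_one (fun _ => flagWeight β)
        fun _ => sum_flagWeight β) G.edgeFinset (fun e k => Sat X σ k e ↔ e ∈ F)
  have hset : ∀ κ : Sym2 V → Option V → Bool,
      satEdges G X σ κ = F ↔ ∀ e ∈ G.edgeFinset, (Sat X σ (κ e) e ↔ e ∈ F) := fun κ => by
    classical
    constructor
    · rintro rfl e he
      simp only [satEdges, mem_filter, he, true_and]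
    · intro H
      ext e
      simp only [satEdges, mem_filter]
      exact ⟨fun ⟨he, hs⟩ => (H e he).mp hs, fun he => ⟨hF he, (H e (hF he)).mpr he⟩⟩
  simp only [hset]
  refine Eq.trans ?_ h.symm
  rw [← prod_sdiff hF]
  have key : ∀ e ∈ G.edgeFinset, ∑ k : Option V → Bool, (∏ i, flagWeight β (k i)) *
      ind (Sat X σ k e) = (pottsMRF V q β).acceptProb X σ e := fun e he => by
    rcases hq with hq | hq
    · exact sum_flagWeight_mul_ind_sat hq β X σ e
        (G.not_isDiag_of_mem_edgeSet (SimpleGraph.mem_edgeFinset.mp he))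
    · simp [hq] at he
  unfold PairwiseMRF.acceptedSetProb
  rw [mul_comm]
  congr 1
  · refine prod_congr rfl fun e he => ?_
    obtain ⟨he, heF⟩ := mem_sdiff.mp he
    simp only [heF, iff_false, ind_not, mul_sub, mul_one, sum_sub_distrib, key e he]
    rw [sum_prod_weight_eq_one (fun _ => flagWeight β) fun _ => sum_flagWeight β]
  · refine prod_congr rfl fun e he => ?_
    simp only [he, iff_true, key e (hF he)]

theorem sum_acceptedSetProb_mul (hq : 2 ≤ q ∨ G.edgeFinset = ∅) (β : ℝ≥0∞) (X : V → Fin q)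
    (σ : V → Option (Fin q)) (g : Finset (Sym2 V) → ℝ) :
    ∑ F ∈ G.edgeFinset.powerset, (pottsMRF V q β).acceptedSetProb G X σ F * g F =
      ∑ κ, flagsWeight β κ * g (satEdges G X σ κ) := by
  rw [sum_congr rfl fun F hF => by
    rw [acceptedSetProb_eq_sum_flags G hq β X σ F (mem_powerset.mp hF), sum_mul], sum_comm]
  refine sum_congr rfl fun κ _ => ?_
  rw [sum_eq_single (satEdges G X σ κ)]
  · rw [ind_of rfl, mul_one]
  · intro F _ hF
    rw [ind_of_not hF.symm, mul_zero, zero_mul]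
  · intro h
    exact absurd (mem_powerset.mpr fun e he => (by
      classical exact (mem_filter.mp he).1)) h

/-- The probability that a vertex makes the given proposal. -/
def proposalWeight (p : ℝ) (q : ℕ) : Option (Fin q) → ℝ
  | none => 1 - p
  | some _ => p / q

theorem pottsMRF_proposalProb (β : ℝ≥0∞) (p : ℝ) (σ : V → Option (Fin q)) :
    (pottsMRF V q β).proposalProb p σ = ∏ v, proposalWeight p q (σ v) := by
  unfold PairwiseMRF.proposalProb
  refine prod_congr rfl fun v _ => ?_
  cases h : σ v <;> simp [pottsMRF, proposalWeight, div_eq_mul_inv]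

theorem sum_proposalWeight (p : ℝ) (hq : 0 < q) : ∑ x, proposalWeight p q x = 1 := by
  have : (q : ℝ) ≠ 0 := by positivity
  rw [Fintype.sum_option]
  simp [proposalWeight]
  field_simp
  ring

theorem proposalWeight_nonneg {p : ℝ} (h0 : 0 ≤ p) (h1 : p ≤ 1) (x : Option (Fin q)) :
    0 ≤ proposalWeight p q x := by
  cases x
  · exact sub_nonneg.mpr h1
  · exact div_nonneg h0 (Nat.cast_nonneg _)

theorem transition_mulVec (β : ℝ≥0∞) (p : ℝ) (g : (V → Fin q) → ℝ) (X : V → Fin q) :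
    ((pottsMRF V q β).transition G p *ᵥ g) X =
      ∑ σ, (∏ v, proposalWeight p q (σ v)) * ∑ F ∈ G.edgeFinset.powerset,
        (pottsMRF V q β).acceptedSetProb G X σ F * g (PairwiseMRF.update G X σ F) := by
  simp only [mulVec, dotProduct, PairwiseMRF.transition, sum_mul]
  rw [sum_comm]
  refine sum_congr rfl fun σ _ => ?_
  simp only [mul_assoc, ← mul_sum, pottsMRF_proposalProb]
  congr 1
  simp only [sum_mul]
  rw [sum_comm]
  refine sum_congr rfl fun F _ => ?_
  simp [ite_mul]

/-- The sum over flags stands outside and its weights do not involve `X`, so two colorings can be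
compared flag by flag. -/
theorem transition_mulVec_eq_sum_flags (hq : 2 ≤ q ∨ G.edgeFinset = ∅) (β : ℝ≥0∞) (p : ℝ)
    (g : (V → Fin q) → ℝ) (X : V → Fin q) :
    ((pottsMRF V q β).transition G p *ᵥ g) X =
      ∑ κ, flagsWeight β κ * ∑ σ, (∏ v, proposalWeight p q (σ v)) *
        g (PairwiseMRF.update G X σ (satEdges G X σ κ)) := by
  simp only [transition_mulVec, sum_acceptedSetProb_mul G hq, mul_sum]
  rw [sum_comm]
  refine sum_congr rfl fun κ _ => sum_congr rfl fun σ _ => ?_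
  ring

end Flags

/-! ### Stationarity of the Gibbs distribution -/

section Stationary

variable {V : Type*} [Fintype V] [DecidableEq V] {q : ℕ} (G : SimpleGraph V) [DecidableRel G.Adj]

/-- Exchange current colors and proposals at the vertices that accept their proposals. -/
def exchange (F : Finset (Sym2 V)) (z : (V → Fin q) × (V → Option (Fin q))) :
    (V → Fin q) × (V → Option (Fin q)) :=
  (PairwiseMRF.update G z.1 z.2 F, fun v =>
    match z.2 v with
    | none => none
    | some c => if ∀ e ∈ G.edgeFinset, v ∈ e → e ∈ F then some (z.1 v) else some c)

/-- Which vertices move depends only on `F` and on which vertices are active, and the exchange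
preserves both. -/
theorem exchange_involutive (F : Finset (Sym2 V)) :
    Function.Involutive (exchange (q := q) G F) := by
  rintro ⟨X, σ⟩
  refine Prod.ext (funext fun v => ?_) (funext fun v => ?_)
  · cases h : σ v with
    | none => simp [exchange, PairwiseMRF.update, h]
    | some c =>
      by_cases ha : ∀ e ∈ G.edgeFinset, v ∈ e → e ∈ F
      · simp only [exchange, PairwiseMRF.update, h, if_pos ha]
      · simp only [exchange, PairwiseMRF.update, h, if_neg ha]
  · cases h : σ v with
    | none => simp [exchange, PairwiseMRF.update, h]
    | some c =>
      by_cases ha : ∀ e ∈ G.edgeFinset, v ∈ e → e ∈ F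
      · simp only [exchange, PairwiseMRF.update, h, if_pos ha]
      · simp only [exchange, PairwiseMRF.update, h, if_neg ha]

theorem prod_proposalWeight_exchange (p : ℝ) (F : Finset (Sym2 V))
    (z : (V → Fin q) × (V → Option (Fin q))) :
    ∏ v, proposalWeight p q ((exchange G F z).2 v) = ∏ v, proposalWeight p q (z.2 v) := by
  refine prod_congr rfl fun v _ => ?_
  cases h : z.2 v with
  | none => simp only [exchange, h]
  | some c =>
    simp only [exchange, h]
    split_ifs <;> rfl

theorem boltzmann_pow_pottsHamiltonian (β : ℝ≥0∞) (X : V → Fin q) :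
    boltzmann β ^ pottsHamiltonian G q X =
      ∏ e ∈ G.edgeFinset, if (e.map X).IsDiag then boltzmann β else 1 := by
  rw [pottsHamiltonian, ← prod_const, prod_filter]

/-- With the Gibbs factor of the current colors, the product runs over all pairs from `{X u, σ u} ×
{X v, σ v}`, so it is symmetric under exchange at either end. An inactive end only drops factors and
is not exchanged. -/
theorem exchange_edge_of_mem (hq : 2 ≤ q) (β : ℝ≥0∞) (F : Finset (Sym2 V))
    (z : (V → Fin q) × (V → Option (Fin q))) (e : Sym2 V) :
    (if (e.map (exchange G F z).1).IsDiag then boltzmann β else 1) *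
        (pottsMRF V q β).acceptProb (exchange G F z).1 (exchange G F z).2 e =
      (if (e.map z.1).IsDiag then boltzmann β else 1) *
        (pottsMRF V q β).acceptProb z.1 z.2 e := by
  obtain ⟨X, σ⟩ := z
  induction e with | _ u v
  simp only [PairwiseMRF.acceptProb, Sym2.lift_mk, pottsMRF_ratio hq, Sym2.map_mk,
    Sym2.mk_isDiag_iff, exchange, PairwiseMRF.update]
  by_cases hu : ∀ e ∈ G.edgeFinset, u ∈ e → e ∈ F <;>
    by_cases hv : ∀ e ∈ G.edgeFinset, v ∈ e → e ∈ F
  · cases σ u <;> cases σ v <;>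
      simp only [if_pos hu, if_pos hv, Option.some.injEq, ne_eq, reduceCtorEq, not_false_eq_true,
        and_true, not_true_eq_false, and_false] <;> ring
  · cases σ u <;> cases σ v <;>
      simp only [if_pos hu, if_neg hv, Option.some.injEq, ne_eq, reduceCtorEq, not_false_eq_true,
        and_true, not_true_eq_false, and_false] <;> ring
  · cases σ u <;> cases σ v <;>
      simp only [if_neg hu, if_pos hv, Option.some.injEq, ne_eq, reduceCtorEq, not_false_eq_true,
        and_true, not_true_eq_false, and_false] <;> ring
  · cases σ u <;> cases σ v <;>
      simp only [if_neg hu, if_neg hv, Option.some.injEq, ne_eq, reduceCtorEq, not_false_eq_true,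
        and_true, not_true_eq_false, and_false]

/-- A rejected edge blocks both its ends, so the exchange does nothing there. -/
theorem exchange_edge_of_notMem (β : ℝ≥0∞) (F : Finset (Sym2 V))
    (z : (V → Fin q) × (V → Option (Fin q))) (e : Sym2 V) (he : e ∈ G.edgeFinset) (heF : e ∉ F) :
    e.map (exchange G F z).1 = e.map z.1 ∧
    (pottsMRF V q β).acceptProb (exchange G F z).1 (exchange G F z).2 e =
      (pottsMRF V q β).acceptProb z.1 z.2 e := by
  obtain ⟨X, σ⟩ := z
  have key : ∀ v ∈ e, (exchange G F (X, σ)).1 v = X v ∧ (exchange G F (X, σ)).2 v = σ v := by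
    intro v hv
    have hn : ¬∀ e ∈ G.edgeFinset, v ∈ e → e ∈ F := fun h => heF (h e he hv)
    cases h : σ v with
    | none => simp [exchange, PairwiseMRF.update, h]
    | some c => simp only [exchange, PairwiseMRF.update, h, if_neg hn, and_self]
  induction e with | _ u v
  obtain ⟨h1, h2⟩ := key u (Sym2.mem_mk_left u v)
  obtain ⟨h3, h4⟩ := key v (Sym2.mem_mk_right u v)
  simp only [PairwiseMRF.acceptProb, Sym2.lift_mk, Sym2.map_mk, h1, h2, h3, h4, and_self]

theorem boltzmann_pow_mul_acceptedSetProb_exchange (hq : 2 ≤ q ∨ G.edgeFinset = ∅) (β : ℝ≥0∞)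
    (F : Finset (Sym2 V)) (hF : F ⊆ G.edgeFinset) (z : (V → Fin q) × (V → Option (Fin q))) :
    boltzmann β ^ pottsHamiltonian G q (exchange G F z).1 *
        (pottsMRF V q β).acceptedSetProb G (exchange G F z).1 (exchange G F z).2 F =
      boltzmann β ^ pottsHamiltonian G q z.1 *
        (pottsMRF V q β).acceptedSetProb G z.1 z.2 F := by
  have split : ∀ z : (V → Fin q) × (V → Option (Fin q)),
      boltzmann β ^ pottsHamiltonian G q z.1 * (pottsMRF V q β).acceptedSetProb G z.1 z.2 F =
      (∏ e ∈ F, (if (e.map z.1).IsDiag then boltzmann β else 1) *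
        (pottsMRF V q β).acceptProb z.1 z.2 e) *
      ∏ e ∈ G.edgeFinset \ F, (if (e.map z.1).IsDiag then boltzmann β else 1) *
        (1 - (pottsMRF V q β).acceptProb z.1 z.2 e) := fun z => by
    rw [boltzmann_pow_pottsHamiltonian, PairwiseMRF.acceptedSetProb, ← prod_sdiff hF,
      prod_mul_distrib, prod_mul_distrib]
    ring
  rw [split, split]
  congr 1
  · refine prod_congr rfl fun e he => ?_
    rcases hq with hq | hq
    · exact exchange_edge_of_mem G hq β F z e
    · have := hF he
      simp [hq] at this
  · refine prod_congr rfl fun e he => ?_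
    obtain ⟨he, heF⟩ := mem_sdiff.mp he
    obtain ⟨h1, h2⟩ := exchange_edge_of_notMem G β F z e he heF
    rw [h1, h2]

/-- For each accepted set `F`, the exchange preserves the joint weight of coloring, proposals and
`F`, and turns the new coloring into the old one; summing over `F` and the proposals then gives
total mass 1. -/
theorem sum_boltzmann_pow_mul_transition_mulVec (hq0 : IsEmpty V ∨ 0 < q)
    (hq : 2 ≤ q ∨ G.edgeFinset = ∅)
    (β : ℝ≥0∞) (p : ℝ) (g : (V → Fin q) → ℝ) :
    ∑ X, boltzmann β ^ pottsHamiltonian G q X * ((pottsMRF V q β).transition G p *ᵥ g) X =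
      ∑ X, boltzmann β ^ pottsHamiltonian G q X * g X := by
  have hsum : ∀ (X : V → Fin q) (σ : V → Option (Fin q)),
      ∑ F ∈ G.edgeFinset.powerset, (pottsMRF V q β).acceptedSetProb G X σ F = 1 := fun X σ => by
    have := sum_acceptedSetProb_mul G hq β X σ fun _ => 1
    simpa only [mul_one, sum_flagsWeight] using this
  have hprop : ∑ σ : V → Option (Fin q), ∏ v, proposalWeight p q (σ v) = 1 :=
    sum_prod_weight_eq_one (fun _ => proposalWeight p q) fun v =>
      sum_proposalWeight p (hq0.resolve_left fun h => h.elim v)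
  calc
    _ = ∑ F ∈ G.edgeFinset.powerset, ∑ z : (V → Fin q) × (V → Option (Fin q)),
        (boltzmann β ^ pottsHamiltonian G q z.1 * (pottsMRF V q β).acceptedSetProb G z.1 z.2 F) *
          (∏ v, proposalWeight p q (z.2 v)) * g (exchange G F z).1 := by
      simp only [transition_mulVec, mul_sum, Fintype.sum_prod_type]
      rw [sum_comm (s := G.edgeFinset.powerset)]
      refine sum_congr rfl fun X _ => ?_
      rw [sum_comm]
      refine sum_congr rfl fun F _ => sum_congr rfl fun σ _ => ?_
      simp only [exchange]
      ring
    _ = ∑ F ∈ G.edgeFinset.powerset, ∑ z : (V → Fin q) × (V → Option (Fin q)),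
        (boltzmann β ^ pottsHamiltonian G q z.1 * (pottsMRF V q β).acceptedSetProb G z.1 z.2 F) *
          (∏ v, proposalWeight p q (z.2 v)) * g z.1 := by
      refine sum_congr rfl fun F hF => ?_
      rw [← Equiv.sum_comp (exchange_involutive G F).toPerm]
      refine sum_congr rfl fun z _ => ?_
      simp only [Function.Involutive.coe_toPerm]
      rw [boltzmann_pow_mul_acceptedSetProb_exchange G hq β F (mem_powerset.mp hF),
        prod_proposalWeight_exchange, exchange_involutive G F z]
    _ = ∑ X, ∑ σ : V → Option (Fin q), boltzmann β ^ pottsHamiltonian G q X *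
          (∏ v, proposalWeight p q (σ v)) * g X := by
      rw [sum_comm, Fintype.sum_prod_type]
      refine sum_congr rfl fun X _ => sum_congr rfl fun σ _ => ?_
      simp only [mul_assoc, ← mul_sum]
      rw [← sum_mul, hsum, one_mul]
    _ = _ := by
      refine sum_congr rfl fun X _ => ?_
      rw [← sum_mul, ← mul_sum, hprop, mul_one]

/-- A graph has a proper coloring with more colors than its maximum degree. -/
theorem exists_pottsHamiltonian_eq_zero (hq : G.maxDegree < q) :
    ∃ X : V → Fin q, pottsHamiltonian G q X = 0 := by
  have : Nonempty (V → Fin q) := ⟨fun _ => ⟨0, by omega⟩⟩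
  -- A minimizer must be proper: otherwise recoloring an end of a monochromatic edge with a color
  -- absent around it removes that edge and creates none.
  obtain ⟨X, hX⟩ := Finite.exists_min (pottsHamiltonian G q)
  refine ⟨X, by_contra fun h => ?_⟩
  obtain ⟨e, he⟩ := card_pos.mp (Nat.pos_of_ne_zero h)
  obtain ⟨heE, hdiag⟩ := mem_filter.mp he
  induction e with | _ u v
  have huv : G.Adj u v := SimpleGraph.mem_edgeFinset.mp heE
  have hcard : ((G.neighborFinset u).image X).card < (univ : Finset (Fin q)).card := by
    rw [card_univ, Fintype.card_fin]
    exact (card_image_le.trans (G.degree_le_maxDegree u)).trans_lt hq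
  obtain ⟨c, -, hc⟩ := exists_mem_notMem_of_card_lt_card hcard
  have hc' : ∀ w, G.Adj u w → X w ≠ c := fun w hw hwc =>
    hc (mem_image.mpr ⟨w, (G.mem_neighborFinset u w).mpr hw, hwc⟩)
  refine absurd (hX (Function.update X u c)) (not_le.mpr (card_lt_card ?_))
  refine (ssubset_iff_of_subset fun e he => ?_).mpr ⟨s(u, v), he, fun h => ?_⟩
  · obtain ⟨heE, hdiag⟩ := mem_filter.mp he
    refine mem_filter.mpr ⟨heE, ?_⟩
    induction e with | _ x y
    have hxy : G.Adj x y := SimpleGraph.mem_edgeFinset.mp heE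
    simp only [Sym2.map_mk, Sym2.mk_isDiag_iff] at hdiag ⊢
    by_cases hx : x = u
    · subst hx
      rw [Function.update_self, Function.update_of_ne hxy.ne'] at hdiag
      exact absurd hdiag.symm (hc' y hxy)
    · by_cases hy : y = u
      · subst hy
        rw [Function.update_self, Function.update_of_ne hx] at hdiag
        exact absurd hdiag (hc' x hxy.symm)
      · rwa [Function.update_of_ne hx, Function.update_of_ne hy] at hdiag
  · have := (mem_filter.mp h).2
    simp only [Sym2.map_mk, Sym2.mk_isDiag_iff, Function.update_self,
      Function.update_of_ne huv.ne'] at this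
    exact hc' v huv this.symm

theorem partitionFunction_pos {S : Type*} [Fintype S] (H : S → ℕ) (β : ℝ≥0∞)
    (hH : ∃ s, H s = 0) : 0 < partitionFunction H β := by
  obtain ⟨s, hs⟩ := hH
  exact sum_pos' (fun s _ => pow_nonneg (boltzmann_nonneg β) _)
    ⟨s, mem_univ s, by rw [hs, pow_zero]; exact one_pos⟩

end Stationary

/-! ### From contraction to mixing -/

section Mixing

variable {V A : Type*} [Fintype V] [DecidableEq V] [DecidableEq A]

/-- `g` changes by at most `L` if one coordinate is changed. -/
def SiteLipschitz (L : ℝ) (g : (V → A) → ℝ) : Prop :=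
  ∀ X v c, |g X - g (Function.update X v c)| ≤ L

theorem SiteLipschitz.abs_sub_le {L : ℝ} {g : (V → A) → ℝ} (hg : SiteLipschitz L g)
    (X Y : V → A) : |g X - g Y| ≤ L * hammingDist X Y := by
  induction h : hammingDist X Y generalizing X with
  | zero => simp [hammingDist_eq_zero.mp h]
  | succ n ih =>
    have hne : X ≠ Y := hammingDist_ne_zero.mp (by omega)
    obtain ⟨v, hv⟩ := Function.ne_iff.mp hne
    have hd : hammingDist (Function.update X v (Y v)) Y = n := by
      have heq : (univ.filter fun i => X i ≠ Y i) =
          insert v (univ.filter fun i => Function.update X v (Y v) i ≠ Y i) := by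
        ext i
        by_cases hi : i = v
        · subst hi; simp [hv]
        · simp [hi]
      have hcard : hammingDist X Y = hammingDist (Function.update X v (Y v)) Y + 1 := by
        unfold hammingDist
        rw [heq, card_insert_of_notMem (by simp)]
      omega
    have h1 := hg X v (Y v)
    have h2 := ih _ hd
    have h3 := _root_.abs_sub_le (g X) (g (Function.update X v (Y v))) (g Y)
    push_cast
    linarith

variable [Fintype A]

theorem SiteLipschitz.pow_mulVec {P : Matrix (V → A) (V → A) ℝ} {r : ℝ}
    (hP : ∀ L g, SiteLipschitz L g → SiteLipschitz (r * L) (P *ᵥ g)) (t : ℕ) {L : ℝ}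
    {g : (V → A) → ℝ} (hg : SiteLipschitz L g) : SiteLipschitz (r ^ t * L) (P ^ t *ᵥ g) := by
  induction t with
  | zero => simpa using hg
  | succ t ih =>
    rw [pow_succ', pow_succ', ← mulVec_mulVec, mul_assoc]
    exact hP _ _ ih

/-- Path coupling in dual form. -/
theorem tvDist_pow_le {P : Matrix (V → A) (V → A) ℝ} {r : ℝ} (hr : 0 ≤ r)
    (hP : ∀ L g, SiteLipschitz L g → SiteLipschitz (r * L) (P *ᵥ g)) (π : (V → A) → ℝ)
    (hπ0 : ∀ X, 0 ≤ π X) (hπ1 : ∑ X, π X = 1) (hπP : ∀ g, ∑ X, π X * (P *ᵥ g) X = ∑ X, π X * g X)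
    (t : ℕ) (X₀ : V → A) : tvDist ((P ^ t) X₀) π ≤ r ^ t * Fintype.card V := by
  have hπt : ∀ t g, ∑ X, π X * (P ^ t *ᵥ g) X = ∑ X, π X * g X := by
    intro t
    induction t with
    | zero => simp
    | succ t ih => intro g; rw [pow_succ', ← mulVec_mulVec, hπP, ih]
  -- The sign function attains the total variation distance; its oscillation 2 cancels the factor
  -- 1/2 in `tvDist`.
  set h : (V → A) → ℝ := fun s => if π s ≤ (P ^ t) X₀ s then 1 else -1 with hh
  have hlip : SiteLipschitz 2 h := fun X v c => by
    simp only [hh]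
    split_ifs <;> norm_num
  have hL := hlip.pow_mulVec hP t
  have habs : ∑ s, |(P ^ t) X₀ s - π s| = (P ^ t *ᵥ h) X₀ - ∑ X, π X * h X := by
    simp only [mulVec, dotProduct]
    rw [← sum_sub_distrib]
    refine sum_congr rfl fun s _ => ?_
    simp only [hh]
    split_ifs with hs
    · rw [abs_of_nonneg (sub_nonneg.mpr hs)]; ring
    · rw [abs_of_neg (sub_neg.mpr (not_le.mp hs))]; ring
  have hcard : ∀ X Y : V → A, |(P ^ t *ᵥ h) X - (P ^ t *ᵥ h) Y| ≤
      r ^ t * 2 * Fintype.card V := fun X Y =>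
    (hL.abs_sub_le X Y).trans (mul_le_mul_of_nonneg_left
      (by exact_mod_cast hammingDist_le_card_fintype) (by positivity))
  have hdiff : (P ^ t *ᵥ h) X₀ - ∑ X, π X * h X =
      ∑ X, π X * ((P ^ t *ᵥ h) X₀ - (P ^ t *ᵥ h) X) := by
    rw [← hπt t]
    simp only [mul_sub, sum_sub_distrib, ← sum_mul, hπ1, one_mul]
  have : ∑ s, |(P ^ t) X₀ s - π s| ≤ r ^ t * 2 * Fintype.card V := by
    rw [habs, hdiff]
    calc
      _ ≤ ∑ X, π X * (r ^ t * 2 * Fintype.card V) := sum_le_sum fun X _ =>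
        mul_le_mul_of_nonneg_left ((le_abs_self _).trans (hcard X₀ X)) (hπ0 X)
      _ = _ := by rw [← sum_mul, hπ1, one_mul]
  unfold tvDist
  linarith

end Mixing

/-! ### The coupling for fixed constraint flags -/

section Coupling

variable {V : Type*} [Fintype V] [DecidableEq V] {q : ℕ} (G : SimpleGraph V) [DecidableRel G.Adj]

/-- The proposal at `u` is tested against the current color of `w`. -/
def Tests (κ : Sym2 V → Option V → Bool) (u w : V) : Prop := κ s(u, w) (some u) = true

theorem sat_mk_iff (κ : Sym2 V → Option V → Bool) (X : V → Fin q) (σ : V → Option (Fin q))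
    (u w : V) : Sat X σ (κ s(u, w)) s(u, w) ↔
      (Tests κ u w → σ u ≠ some (X w)) ∧ (Tests κ w u → σ w ≠ some (X u)) ∧
      (κ s(u, w) none = true → ¬(σ u = σ w ∧ σ u ≠ none)) := by
  unfold Tests
  rw [Sym2.eq_swap (a := w) (b := u)]
  exact Iff.rfl

/-- The new coloring when the constraints flagged by `κ` are in force. -/
def hardUpdate (κ : Sym2 V → Option V → Bool) (X : V → Fin q) (σ : V → Option (Fin q)) :
    V → Fin q :=
  PairwiseMRF.update G X σ (satEdges G X σ κ)

theorem forall_mem_satEdges_iff (κ : Sym2 V → Option V → Bool) (X : V → Fin q)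
    (σ : V → Option (Fin q)) (u : V) :
    (∀ e ∈ G.edgeFinset, u ∈ e → e ∈ satEdges G X σ κ) ↔
      ∀ w, G.Adj u w → Sat X σ (κ s(u, w)) s(u, w) := by
  classical
  simp only [satEdges, mem_filter]
  constructor
  · intro h w hw
    exact (h s(u, w) (SimpleGraph.mem_edgeFinset.mpr hw) (Sym2.mem_mk_left u w)).2
  · intro h e he hu
    refine ⟨he, ?_⟩
    obtain ⟨w, rfl⟩ := hu
    exact h w (SimpleGraph.mem_edgeFinset.mp he)

theorem hardUpdate_of_none {κ : Sym2 V → Option V → Bool} {X : V → Fin q}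
    {σ : V → Option (Fin q)} {u : V} (h : σ u = none) : hardUpdate G κ X σ u = X u := by
  simp only [hardUpdate, PairwiseMRF.update, h]

theorem hardUpdate_of_forall_sat {κ : Sym2 V → Option V → Bool} {X : V → Fin q}
    {σ : V → Option (Fin q)} {u : V} {c : Fin q} (h : σ u = some c)
    (hs : ∀ w, G.Adj u w → Sat X σ (κ s(u, w)) s(u, w)) : hardUpdate G κ X σ u = c := by
  simp only [hardUpdate, PairwiseMRF.update, h]
  rw [if_pos ((forall_mem_satEdges_iff G κ X σ u).mpr hs)]

theorem hardUpdate_of_not_sat {κ : Sym2 V → Option V → Bool} {X : V → Fin q}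
    {σ : V → Option (Fin q)} {u w : V} (hw : G.Adj u w)
    (hs : ¬Sat X σ (κ s(u, w)) s(u, w)) : hardUpdate G κ X σ u = X u := by
  cases h : σ u with
  | none => exact hardUpdate_of_none G h
  | some c =>
    simp only [hardUpdate, PairwiseMRF.update, h]
    rw [if_neg fun H => hs ((forall_mem_satEdges_iff G κ X σ u).mp H w hw)]

theorem hardUpdate_congr {κ : Sym2 V → Option V → Bool} {X Y : V → Fin q}
    {σ τ : V → Option (Fin q)} {u : V} (hX : X u = Y u) (hσ : σ u = τ u)
    (hs : ∀ w, G.Adj u w → (Sat X σ (κ s(u, w)) s(u, w) ↔ Sat Y τ (κ s(u, w)) s(u, w))) :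
    hardUpdate G κ X σ u = hardUpdate G κ Y τ u := by
  cases h : σ u with
  | none => rw [hardUpdate_of_none G h, hardUpdate_of_none G (hσ ▸ h), hX]
  | some c =>
    by_cases H : ∀ w, G.Adj u w → Sat X σ (κ s(u, w)) s(u, w)
    · rw [hardUpdate_of_forall_sat G h H,
        hardUpdate_of_forall_sat G (hσ ▸ h) fun w hw => (hs w hw).mp (H w hw)]
    · push Not at H
      obtain ⟨w, hw, hn⟩ := H
      rw [hardUpdate_of_not_sat G hw hn, hardUpdate_of_not_sat G hw (mt (hs w hw).mpr hn), hX]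

/-- The neighbors of `v` at which the coupled proposals have the colors `a` and `b` exchanged: those
that test against `v`, and against no other vertex of color `a` or `b`. -/
def Swaps (κ : Sym2 V → Option V → Bool) (X : V → Fin q) (v : V) (a b : Fin q) (u : V) : Prop :=
  G.Adj v u ∧ Tests κ u v ∧ ∀ w, G.Adj u w → w ≠ v → Tests κ u w → X w ≠ a ∧ X w ≠ b

/-- The coupled proposals. -/
def swapProposals (κ : Sym2 V → Option V → Bool) (X : V → Fin q) (v : V) (a b : Fin q)
    (σ : V → Option (Fin q)) : V → Option (Fin q) := fun u =>
  open Classical in if Swaps G κ X v a b u then (σ u).map (Equiv.swap a b) else σ u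

theorem swapProposals_of_not_swaps {κ : Sym2 V → Option V → Bool} {X : V → Fin q} {v : V}
    {a b : Fin q} {σ : V → Option (Fin q)} {u : V} (h : ¬Swaps G κ X v a b u) :
    swapProposals G κ X v a b σ u = σ u := if_neg h

theorem swapProposals_of_swaps {κ : Sym2 V → Option V → Bool} {X : V → Fin q} {v : V}
    {a b : Fin q} {σ : V → Option (Fin q)} {u : V} (h : Swaps G κ X v a b u) :
    swapProposals G κ X v a b σ u = (σ u).map (Equiv.swap a b) := if_pos h

theorem swapProposals_of_ne {κ : Sym2 V → Option V → Bool} {X : V → Fin q} {v : V}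
    {a b : Fin q} {σ : V → Option (Fin q)} {u : V} (ha : σ u ≠ some a) (hb : σ u ≠ some b) :
    swapProposals G κ X v a b σ u = σ u := by
  by_cases h : Swaps G κ X v a b u
  · rw [swapProposals_of_swaps G h]
    cases hu : σ u with
    | none => rfl
    | some c =>
      rw [Option.map_some, Equiv.swap_apply_of_ne_of_ne]
      · rintro rfl; exact ha hu
      · rintro rfl; exact hb hu
  · exact swapProposals_of_not_swaps G h

/-- The set of exchanging vertices does not depend on the proposals, so the coupling is a bijection
of the proposal space. -/
theorem swapProposals_involutive (κ : Sym2 V → Option V → Bool) (X : V → Fin q) (v : V)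
    (a b : Fin q) : Function.Involutive (swapProposals G κ X v a b) := by
  intro σ
  funext u
  by_cases h : Swaps G κ X v a b u
  · rw [swapProposals_of_swaps G h, swapProposals_of_swaps G h]
    cases σ u <;> simp
  · rw [swapProposals_of_not_swaps G h, swapProposals_of_not_swaps G h]

theorem prod_proposalWeight_swapProposals (p : ℝ) (κ : Sym2 V → Option V → Bool) (X : V → Fin q)
    (v : V) (a b : Fin q) (σ : V → Option (Fin q)) :
    ∏ u, proposalWeight p q (swapProposals G κ X v a b σ u) =
      ∏ u, proposalWeight p q (σ u) := by
  refine prod_congr rfl fun u _ => ?_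
  by_cases h : Swaps G κ X v a b u
  · rw [swapProposals_of_swaps G h]
    cases σ u <;> rfl
  · rw [swapProposals_of_not_swaps G h]

/-- The only one of the colors `a` and `b` whose proposal at the neighbor `u` of `v` can create a
disagreement by itself. -/
def riskyColor (κ : Sym2 V → Option V → Bool) (X : V → Fin q) (v : V) (a b : Fin q) (u : V) :
    Fin q :=
  open Classical in
  if Swaps G κ X v a b u ∨ ∃ w, G.Adj u w ∧ w ≠ v ∧ Tests κ u w ∧ X w = a then b else a

variable {κ : Sym2 V → Option V → Bool} {X : V → Fin q} {v : V} {b : Fin q}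
  {σ : V → Option (Fin q)}

/-- The hypotheses exclude the two sources of new disagreement: a risky proposal at a neighbor of
`v`, and adjacent proposals from `{X v, b}` that could interact through an exchange. -/
theorem hardUpdate_swapProposals_of_ne {u : V} (huv : u ≠ v)
    (h1 : G.Adj v u → σ u ≠ some (riskyColor G κ X v (X v) b u))
    (h2 : ∀ w, G.Adj v w → G.Adj w u → (σ w = some (X v) ∨ σ w = some b) →
      ¬(σ u = some (X v) ∨ σ u = some b)) :
    hardUpdate G κ X σ u =
      hardUpdate G κ (Function.update X v b) (swapProposals G κ X v (X v) b σ) u := by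
  set Y := Function.update X v b with hY
  set τ := swapProposals G κ X v (X v) b σ with hτ
  have hYne : ∀ w, w ≠ v → Y w = X w := fun w hw => Function.update_of_ne hw _ _
  have hYv : Y v = b := Function.update_self _ _ _
  by_cases hS : Swaps G κ X v (X v) b u ∧ (σ u = some (X v) ∨ σ u = some b)
  · obtain ⟨hS, hu⟩ := hS
    have hrisk : riskyColor G κ X v (X v) b u = b := if_pos (Or.inl hS)
    rcases hu with hu | hu
    -- Both copies propose at `u` the color that `v` has in that copy, and both are rejected by `v`.
    · have hτu : τ u = some b := by
        rw [hτ, swapProposals_of_swaps G hS, hu, Option.map_some, Equiv.swap_apply_left]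
      rw [hardUpdate_of_not_sat G hS.1.symm, hardUpdate_of_not_sat G hS.1.symm, hYne u huv]
      · rw [sat_mk_iff]
        exact fun h => h.1 hS.2.1 (by rw [hτu, hYv])
      · rw [sat_mk_iff]
        exact fun h => h.1 hS.2.1 hu
    · exact absurd (hu.trans (congrArg some hrisk.symm)) (h1 hS.1)
  · have hτu : τ u = σ u := by
      by_cases hS' : Swaps G κ X v (X v) b u
      · have := not_or.mp fun h => hS ⟨hS', h⟩
        exact swapProposals_of_ne G this.1 this.2
      · exact swapProposals_of_not_swaps G hS'
    have hτv : τ v = σ v := swapProposals_of_not_swaps G fun h => G.irrefl h.1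
    have hsat : ∀ w, G.Adj u w → w ≠ v →
        (Sat X σ (κ s(u, w)) s(u, w) ↔ Sat Y τ (κ s(u, w)) s(u, w)) := by
      intro w hw hwv
      rw [sat_mk_iff, sat_mk_iff, hτu, hYne w hwv, hYne u huv]
      -- If the proposal at `w` is exchanged, it stays in `{X v, b}`. It cannot clash with the
      -- proposal at `u`, by `h2`, nor with the color of `u`, which is neither of the two whenever
      -- `w` is tested against `u`.
      by_cases hw' : Swaps G κ X v (X v) b w ∧ (σ w = some (X v) ∨ σ w = some b)
      · obtain ⟨hSw, hσw⟩ := hw'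
        have hσu := h2 w hSw.1 hw.symm hσw
        have hτw : τ w = some (X v) ∨ τ w = some b := by
          rw [hτ, swapProposals_of_swaps G hSw]
          rcases hσw with h | h <;> rw [h] <;> simp
        have hne : ∀ x, (x = some (X v) ∨ x = some b) →
            ((Tests κ w u → x ≠ some (X u)) ∧
              (κ s(u, w) none = true → ¬(σ u = x ∧ σ u ≠ none))) := by
          intro x hx
          refine ⟨fun ht hxu => ?_, fun _ h => hσu (h.1 ▸ hx)⟩
          obtain ⟨hXa, hXb⟩ := hSw.2.2 u hw.symm huv ht
          rcases hx with hx | hx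
          · exact hXa (Option.some.inj (hxu.symm.trans hx))
          · exact hXb (Option.some.inj (hxu.symm.trans hx))
        exact and_congr Iff.rfl ⟨fun _ => hne _ hτw, fun _ => hne _ hσw⟩
      · have hτw : τ w = σ w := by
          by_cases hSw : Swaps G κ X v (X v) b w
          · have := not_or.mp fun h => hw' ⟨hSw, h⟩
            exact swapProposals_of_ne G this.1 this.2
          · exact swapProposals_of_not_swaps G hSw
        rw [hτw]
    -- Only the test of `u` against `v` can still see the difference. If it does, `u` does not
    -- exchange, and since its proposal is not risky, another tested vertex has the proposed color
    -- and rejects it in both copies.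
    by_cases hbad : G.Adj u v ∧ Tests κ u v ∧ (σ u = some (X v) ∨ σ u = some b)
    · obtain ⟨huv', ht, hσu⟩ := hbad
      have hSu : ¬Swaps G κ X v (X v) b u := fun h => hS ⟨h, hσu⟩
      have h1 := h1 huv'.symm
      obtain ⟨w, hw, hwv, htw, hσw⟩ : ∃ w, G.Adj u w ∧ w ≠ v ∧ Tests κ u w ∧
          σ u = some (X w) := by
        by_cases hex : ∃ w, G.Adj u w ∧ w ≠ v ∧ Tests κ u w ∧ X w = X v
        · rw [riskyColor, if_pos (Or.inr hex)] at h1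
          obtain ⟨w, hw, hwv, htw, hXw⟩ := hex
          exact ⟨w, hw, hwv, htw, hXw ▸ hσu.resolve_right h1⟩
        · rw [riskyColor, if_neg (not_or.mpr ⟨hSu, hex⟩)] at h1
          by_contra hno
          refine hSu ⟨huv'.symm, ht, fun w hw hwv htw => ⟨fun h => hex ⟨w, hw, hwv, htw, h⟩,
            fun h => hno ⟨w, hw, hwv, htw, h ▸ hσu.resolve_left h1⟩⟩⟩
      have hn : ¬Sat X σ (κ s(u, w)) s(u, w) := by
        rw [sat_mk_iff]
        exact fun h => h.1 htw hσw
      rw [hardUpdate_of_not_sat G hw hn,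
        hardUpdate_of_not_sat G hw (mt (hsat w hw hwv).mpr hn), hYne u huv]
    · refine hardUpdate_congr G (hYne u huv).symm hτu.symm fun w hw => ?_
      by_cases hwv : w = v
      · subst hwv
        rw [sat_mk_iff, sat_mk_iff, hτu, hτv, hYne u huv, hYv]
        refine and_congr ⟨fun _ ht h => hbad ⟨hw, ht, Or.inr h⟩,
          fun _ ht h => hbad ⟨hw, ht, Or.inl h⟩⟩ Iff.rfl
      · exact hsat w hw hwv

/-- No edge at `v` objects in either copy, so both move to `c` and the disagreement heals. -/
theorem hardUpdate_swapProposals_self {c : Fin q} (hc : σ v = some c)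
    (hX : ∀ u, G.Adj v u → X u ≠ c)
    (hσ : ∀ u, G.Adj v u → σ u ≠ some (X v) ∧ σ u ≠ some b ∧ σ u ≠ some c) :
    hardUpdate G κ X σ v =
      hardUpdate G κ (Function.update X v b) (swapProposals G κ X v (X v) b σ) v := by
  have hτv : swapProposals G κ X v (X v) b σ v = σ v :=
    swapProposals_of_not_swaps G fun h => G.irrefl h.1
  rw [hardUpdate_of_forall_sat G hc, hardUpdate_of_forall_sat G (hτv.trans hc)]
  · intro u hu
    obtain ⟨ha, hb, hc'⟩ := hσ u hu
    rw [sat_mk_iff, hτv, swapProposals_of_ne G ha hb, Function.update_of_ne hu.ne',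
      Function.update_self, hc]
    exact ⟨fun _ h => hX u hu (Option.some.inj h).symm, fun _ => hb, fun _ h => hc' h.1.symm⟩
  · intro u hu
    obtain ⟨ha, hb, hc'⟩ := hσ u hu
    rw [sat_mk_iff, hc]
    exact ⟨fun _ h => hX u hu (Option.some.inj h).symm, fun _ => ha, fun _ h => hc' h.1.symm⟩

/-! ### The expected number of disagreements -/

/-- The indicator that `u` proposes the color `c`. -/
def proposes (u : V) (c : Fin q) : (V → Option (Fin q)) → ℝ := fun σ => ind (σ u = some c)

theorem proposes_nonneg (u : V) (c : Fin q) (σ : V → Option (Fin q)) : 0 ≤ proposes u c σ :=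
  ind_nonneg _

theorem proposes_of {u : V} {c : Fin q} (h : σ u = some c) : proposes u c σ = 1 := ind_of h

theorem proposes_of_not {u : V} {c : Fin q} (h : ¬σ u = some c) : proposes u c σ = 0 :=
  ind_of_not h

/-- The colors that do not occur in the neighborhood of `v`. -/
def freeColors (X : V → Fin q) (v : V) : Finset (Fin q) := univ \ (G.neighborFinset v).image X

/-- At most one summand is nonzero, that of the color proposed by `v`; the inner sum is a union
bound over the neighbors that could prevent healing. -/
theorem ind_disagree_self_le :
    ind (hardUpdate G κ X σ v ≠
        hardUpdate G κ (Function.update X v b) (swapProposals G κ X v (X v) b σ) v) ≤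
      1 - ∑ c ∈ freeColors G X v, proposes v c σ * (1 - ∑ u ∈ G.neighborFinset v,
        (proposes u (X v) σ + proposes u b σ + proposes u c σ)) := by
  by_cases h : ∃ c ∈ freeColors G X v, σ v = some c
  · obtain ⟨c, hc, hσ⟩ := h
    rw [sum_eq_single c ?_ (fun h => absurd hc h), proposes_of hσ, one_mul, sub_sub_cancel]
    · have hnn : ∀ u ∈ G.neighborFinset v,
          0 ≤ proposes u (X v) σ + proposes u b σ + proposes u c σ := fun u _ =>
        add_nonneg (add_nonneg (proposes_nonneg _ _ _) (proposes_nonneg _ _ _))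
          (proposes_nonneg _ _ _)
      by_cases hu : ∀ u, G.Adj v u → σ u ≠ some (X v) ∧ σ u ≠ some b ∧ σ u ≠ some c
      · rw [ind_of_not]
        · exact sum_nonneg hnn
        · refine not_not.mpr (hardUpdate_swapProposals_self G hσ (fun u hu hXu => ?_) hu)
          exact (mem_sdiff.mp hc).2
            (mem_image.mpr ⟨u, (G.mem_neighborFinset v u).mpr hu, hXu⟩)
      · refine (ind_le_one _).trans ?_
        push Not at hu
        obtain ⟨u, hvu, hu⟩ := hu
        refine le_trans ?_ (single_le_sum hnn ((G.mem_neighborFinset v u).mpr hvu))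
        have ha := proposes_nonneg u (X v) σ
        have hb := proposes_nonneg u b σ
        have hc := proposes_nonneg u c σ
        by_cases h1 : σ u = some (X v)
        · rw [proposes_of h1]; linarith
        · by_cases h2 : σ u = some b
          · rw [proposes_of h2]; linarith
          · rw [proposes_of (hu h1 h2)]; linarith
    · intro c' _ hne
      rw [proposes_of_not fun h => hne (Option.some.inj (h.symm.trans hσ)), zero_mul]
  · push Not at h
    rw [sum_eq_zero fun c hc => by rw [proposes_of_not (h c hc), zero_mul], sub_zero]
    exact ind_le_one _

theorem ind_disagree_le {u : V} (huv : u ≠ v) :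
    ind (hardUpdate G κ X σ u ≠
        hardUpdate G κ (Function.update X v b) (swapProposals G κ X v (X v) b σ) u) ≤
      (if u ∈ G.neighborFinset v then proposes u (riskyColor G κ X v (X v) b u) σ else 0) +
      ∑ w ∈ G.neighborFinset v, if u ∈ G.neighborFinset w then
        (proposes w (X v) σ + proposes w b σ) * (proposes u (X v) σ + proposes u b σ) else 0 := by
  have hnn : ∀ w, 0 ≤ proposes w (X v) σ + proposes w b σ := fun w =>
    add_nonneg (proposes_nonneg _ _ _) (proposes_nonneg _ _ _)
  have hone : ∀ w, (σ w = some (X v) ∨ σ w = some b) →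
      1 ≤ proposes w (X v) σ + proposes w b σ := by
    intro w hw
    have ha := proposes_nonneg w (X v) σ
    have hb := proposes_nonneg w b σ
    rcases hw with h | h
    · rw [proposes_of h]; linarith
    · rw [proposes_of h]; linarith
  have h1nn : 0 ≤ if u ∈ G.neighborFinset v then
      proposes u (riskyColor G κ X v (X v) b u) σ else 0 := by
    split_ifs
    · exact proposes_nonneg _ _ _
    · exact le_rfl
  have hterm : ∀ w ∈ G.neighborFinset v, 0 ≤ if u ∈ G.neighborFinset w then
      (proposes w (X v) σ + proposes w b σ) * (proposes u (X v) σ + proposes u b σ) else 0 := by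
    intro w _
    split_ifs
    · exact mul_nonneg (hnn w) (hnn u)
    · exact le_rfl
  have h2nn := sum_nonneg hterm
  by_cases h1 : G.Adj v u → σ u ≠ some (riskyColor G κ X v (X v) b u)
  · by_cases h2 : ∀ w, G.Adj v w → G.Adj w u → (σ w = some (X v) ∨ σ w = some b) →
        ¬(σ u = some (X v) ∨ σ u = some b)
    · rw [ind_of_not (not_not.mpr (hardUpdate_swapProposals_of_ne G huv h1 h2))]
      exact add_nonneg h1nn h2nn
    · refine (ind_le_one _).trans ?_
      simp only [not_forall, not_not] at h2
      obtain ⟨w, hvw, hwu, hσw, hσu⟩ := h2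
      refine le_trans ?_ (le_add_of_nonneg_left h1nn)
      refine le_trans ?_ (single_le_sum hterm ((G.mem_neighborFinset v w).mpr hvw))
      rw [if_pos ((G.mem_neighborFinset w u).mpr hwu)]
      exact one_le_mul_of_one_le_of_one_le (hone w hσw) (hone u hσu)
  · refine (ind_le_one _).trans ?_
    simp only [not_forall, not_not] at h1
    obtain ⟨hvu, hσu⟩ := h1
    rw [if_pos ((G.mem_neighborFinset v u).mpr hvu), proposes_of hσu]
    exact le_add_of_nonneg_right h2nn

/-- An upper bound for the number of disagreements, as a function of the proposals. -/
def disagreeBound (κ : Sym2 V → Option V → Bool) (X : V → Fin q) (v : V) (b : Fin q) :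
    (V → Option (Fin q)) → ℝ :=
  (1 - ∑ c ∈ freeColors G X v, proposes v c * (1 - ∑ u ∈ G.neighborFinset v,
      (proposes u (X v) + proposes u b + proposes u c))) +
  (∑ u ∈ G.neighborFinset v, proposes u (riskyColor G κ X v (X v) b u) +
  ∑ w ∈ G.neighborFinset v, ∑ u ∈ G.neighborFinset w,
    (proposes w (X v) + proposes w b) * (proposes u (X v) + proposes u b))

theorem hammingDist_hardUpdate_le (κ : Sym2 V → Option V → Bool) (X : V → Fin q) (v : V)
    (b : Fin q) (σ : V → Option (Fin q)) :
    (hammingDist (hardUpdate G κ X σ)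
      (hardUpdate G κ (Function.update X v b) (swapProposals G κ X v (X v) b σ)) : ℝ) ≤
      disagreeBound G κ X v b σ := by
  have hd : ∀ Z W : V → Fin q, (hammingDist Z W : ℝ) = ∑ u, ind (Z u ≠ W u) := fun Z W => by
    simp only [hammingDist, ind, card_filter, Nat.cast_sum, Nat.cast_ite, Nat.cast_one,
      Nat.cast_zero]
    exact sum_congr rfl fun u _ => by congr
  rw [hd, ← add_sum_erase univ _ (mem_univ v)]
  simp only [disagreeBound, Pi.add_apply, Pi.sub_apply, Pi.one_apply, Finset.sum_apply,
    Pi.mul_apply]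
  refine add_le_add (ind_disagree_self_le G) ?_
  have hnn : ∀ w, 0 ≤ proposes w (X v) σ + proposes w b σ := fun w =>
    add_nonneg (proposes_nonneg _ _ _) (proposes_nonneg _ _ _)
  calc
    _ ≤ ∑ u ∈ univ.erase v, ((if u ∈ G.neighborFinset v then
          proposes u (riskyColor G κ X v (X v) b u) σ else 0) +
        ∑ w ∈ G.neighborFinset v, if u ∈ G.neighborFinset w then
          (proposes w (X v) σ + proposes w b σ) * (proposes u (X v) σ + proposes u b σ)
          else 0) :=
      sum_le_sum fun u hu => ind_disagree_le G (ne_of_mem_erase hu)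
    _ ≤ ∑ u, ((if u ∈ G.neighborFinset v then
          proposes u (riskyColor G κ X v (X v) b u) σ else 0) +
        ∑ w ∈ G.neighborFinset v, if u ∈ G.neighborFinset w then
          (proposes w (X v) σ + proposes w b σ) * (proposes u (X v) σ + proposes u b σ)
          else 0) := by
      refine sum_le_sum_of_subset_of_nonneg (erase_subset _ _) fun u _ _ =>
        add_nonneg ?_ (sum_nonneg fun w _ => ?_)
      · split_ifs
        · exact proposes_nonneg _ _ _
        · exact le_rfl
      · split_ifs
        · exact mul_nonneg (hnn w) (hnn u)
        · exact le_rfl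
    _ = _ := by
      rw [sum_add_distrib, sum_comm (s := univ)]
      simp only [sum_ite_mem, univ_inter]

/-- The mean of a function of the proposals. -/
def proposalMean (p : ℝ) : ((V → Option (Fin q)) → ℝ) →ₗ[ℝ] ℝ where
  toFun f := ∑ σ, (∏ v, proposalWeight p q (σ v)) * f σ
  map_add' f g := by simp only [Pi.add_apply, mul_add, sum_add_distrib]
  map_smul' c f := by
    simp only [Pi.smul_apply, smul_eq_mul, RingHom.id_apply, mul_sum]
    exact sum_congr rfl fun σ _ => by ring

/-! ### Expected disagreement under the product law of the proposals -/

theorem proposalMean_one (p : ℝ) (hq : 0 < q) :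
    proposalMean p (1 : (V → Option (Fin q)) → ℝ) = 1 := by
  simp only [proposalMean, LinearMap.coe_mk, AddHom.coe_mk, Pi.one_apply, mul_one]
  exact sum_prod_weight_eq_one (fun _ => proposalWeight p q) fun _ => sum_proposalWeight p hq

theorem proposalMean_proposes (p : ℝ) (hq : 0 < q) (u : V) (c : Fin q) :
    proposalMean p (proposes u c) = p / q :=
  sum_prod_weight_mul_ind_eq (proposalWeight p q) (sum_proposalWeight p hq) u (some c)

theorem proposalMean_proposes_mul (p : ℝ) (hq : 0 < q) {u w : V} (huw : u ≠ w) (c d : Fin q) :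
    proposalMean p (proposes u c * proposes w d) = p / q * (p / q) :=
  sum_prod_weight_mul_ind_eq_mul_ind_eq (proposalWeight p q) (sum_proposalWeight p hq) huw
    (some c) (some d)

theorem proposalMean_disagreeBound (p : ℝ) (hq : 0 < q) (κ : Sym2 V → Option V → Bool)
    (X : V → Fin q) (v : V) (b : Fin q) :
    proposalMean p (disagreeBound G κ X v b) =
      1 - ((freeColors G X v).card : ℝ) * (p / q - G.degree v * (3 * (p / q * (p / q)))) +
      (G.degree v * (p / q) + (∑ w ∈ G.neighborFinset v, (G.degree w : ℝ)) *
        (4 * (p / q * (p / q)))) := by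
  have h1 : ∀ c, proposalMean p (proposes v c * (1 - ∑ u ∈ G.neighborFinset v,
      (proposes u (X v) + proposes u b + proposes u c))) =
      p / q - G.degree v * (3 * (p / q * (p / q))) := by
    intro c
    simp only [mul_sub, mul_one, mul_sum, mul_add, map_sub, map_sum, map_add,
      proposalMean_proposes p hq]
    have h : ∀ u ∈ G.neighborFinset v, proposalMean p (proposes v c * proposes u (X v)) +
        proposalMean p (proposes v c * proposes u b) +
        proposalMean p (proposes v c * proposes u c) = 3 * (p / q * (p / q)) := fun u hu => by
      have hne := ((G.mem_neighborFinset v u).mp hu).ne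
      rw [proposalMean_proposes_mul p hq hne, proposalMean_proposes_mul p hq hne,
        proposalMean_proposes_mul p hq hne]
      ring
    rw [sum_congr rfl h, sum_const, G.card_neighborFinset_eq_degree, nsmul_eq_mul]
  have h2 : ∀ w u : V, w ≠ u → proposalMean p
      ((proposes w (X v) + proposes w b) * (proposes u (X v) + proposes u b)) =
      4 * (p / q * (p / q)) := by
    intro w u hne
    simp only [mul_add, add_mul, map_add, proposalMean_proposes_mul p hq hne]
    ring
  unfold disagreeBound
  simp only [map_add, map_sub, map_sum, proposalMean_one p hq, h1, proposalMean_proposes p hq,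
    sum_const, G.card_neighborFinset_eq_degree, nsmul_eq_mul]
  rw [sum_congr rfl fun w _ => sum_congr rfl fun u hu =>
    h2 w u ((G.mem_neighborFinset w u).mp hu).ne]
  simp only [sum_const, G.card_neighborFinset_eq_degree, nsmul_eq_mul, sum_mul]

/-- To first order, healing at `v` gains `p (1 - 1 / α)` and the risky neighbors lose `p / α`. The
term `3 / α` comes from neighbors of `v` preventing healing, and `4 / α ^ 2` from paths of length
two starting at `v`. -/
theorem proposalMean_disagreeBound_le {p α : ℝ} (hα : 0 < α) (h0 : 0 ≤ p) (hq : 0 < q)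
    (hΔ : α * G.maxDegree ≤ q) (κ : Sym2 V → Option V → Bool)
    (X : V → Fin q) (v : V) (b : Fin q) :
    proposalMean p (disagreeBound G κ X v b) ≤
      1 - p * (1 - 2 / α) + p ^ 2 * (3 / α + 4 / α ^ 2) := by
  rw [proposalMean_disagreeBound G p hq]
  have hq' : (0 : ℝ) < q := by exact_mod_cast hq
  have hdeg : ∀ w, (G.degree w : ℝ) ≤ q / α := fun w => by
    rw [le_div_iff₀ hα, mul_comm]
    refine le_trans (mul_le_mul_of_nonneg_left ?_ hα.le) hΔ
    exact_mod_cast G.degree_le_maxDegree w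
  have hg1 : ((freeColors G X v).card : ℝ) ≤ q := by
    exact_mod_cast (card_le_univ _).trans_eq (Fintype.card_fin q)
  have hg2 : (q : ℝ) - G.degree v ≤ (freeColors G X v).card := by
    have h := card_le_card_sdiff_add_card (t := (G.neighborFinset v).image X)
      (s := (univ : Finset (Fin q)))
    have h' : q ≤ (freeColors G X v).card + G.degree v := by
      have hi : ((G.neighborFinset v).image X).card ≤ G.degree v := card_image_le
      rw [card_univ, Fintype.card_fin] at h
      exact h.trans (Nat.add_le_add_left hi _)
    have h'' : (q : ℝ) ≤ (freeColors G X v).card + G.degree v := by exact_mod_cast h'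
    linarith
  have hs : ∑ w ∈ G.neighborFinset v, (G.degree w : ℝ) ≤ q / α * (q / α) := by
    refine (sum_le_sum fun w _ => hdeg w).trans ?_
    rw [sum_const, G.card_neighborFinset_eq_degree, nsmul_eq_mul]
    exact mul_le_mul_of_nonneg_right (hdeg v) (by positivity)
  have hd0 : (0 : ℝ) ≤ G.degree v := Nat.cast_nonneg _
  set r : ℝ := p / q with hr
  have hr0 : 0 ≤ r := by positivity
  have hqr : q * r = p := by rw [hr]; field_simp
  set g : ℝ := ((freeColors G X v).card : ℝ)
  set d : ℝ := (G.degree v : ℝ)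
  have e1 : (q - d) * r ≤ g * r := mul_le_mul_of_nonneg_right hg2 hr0
  have e2 : d * r ≤ q / α * r := mul_le_mul_of_nonneg_right (hdeg v) hr0
  have e3 : g * d * (3 * (r * r)) ≤ q * (q / α) * (3 * (r * r)) :=
    mul_le_mul_of_nonneg_right (mul_le_mul hg1 (hdeg v) hd0 hq'.le) (by positivity)
  have e4 := mul_le_mul_of_nonneg_right hs (by positivity : 0 ≤ 4 * (r * r))
  have i2 : (q : ℝ) / α * r = p / α := by rw [← hqr]; ring
  have i3 : (q : ℝ) * (q / α) * (3 * (r * r)) = 3 * p ^ 2 / α := by rw [← hqr]; ring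
  have i4 : (q : ℝ) / α * (q / α) * (4 * (r * r)) = 4 * p ^ 2 / α ^ 2 := by rw [← hqr]; ring
  have goal_eq : 1 - p * (1 - 2 / α) + p ^ 2 * (3 / α + 4 / α ^ 2) =
      1 - p + 2 * (p / α) + 3 * p ^ 2 / α + 4 * p ^ 2 / α ^ 2 := by ring
  rw [goal_eq]
  nlinarith [e1, e2, e3, e4, i2, i3, i4, hqr]

/-- One transition contracts site-Lipschitz constants. -/
theorem SiteLipschitz.transition_mulVec {β : ℝ≥0∞} {p α : ℝ} (hα : 2 < α) (h0 : 0 < p)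
    (h1 : p ≤ (1 - 2 / α) / 5) (hq : 0 < q) (hq2 : 2 ≤ q ∨ G.edgeFinset = ∅)
    (hΔ : α * G.maxDegree ≤ q) {L : ℝ} {g : (V → Fin q) → ℝ} (hg : SiteLipschitz L g) :
    SiteLipschitz ((1 - p * (1 - 2 / α) / 2) * L) ((pottsMRF V q β).transition G p *ᵥ g) := by
  intro X v b
  have hL : 0 ≤ L := (abs_nonneg _).trans (hg X v b)
  have hα0 : 0 < α := by linarith
  have hε : 0 < 1 - 2 / α := by rw [sub_pos, div_lt_one hα0]; exact hα
  have hε1 : 1 - 2 / α ≤ 1 := by linarith [div_nonneg zero_le_two hα0.le]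
  have hp1 : p ≤ 1 := by linarith
  have hrate : 1 - p * (1 - 2 / α) + p ^ 2 * (3 / α + 4 / α ^ 2) ≤
      1 - p * (1 - 2 / α) / 2 := by
    -- Since `α > 2`, the coefficient of `p ^ 2` is at most `3 / 2 + 1`; with `p ≤ (1 - 2 / α) / 5`
    -- the quadratic term uses up at most half of the linear gain.
    have hi : 1 / α ≤ 1 / 2 := one_div_le_one_div_of_le two_pos hα.le
    have hi0 : 0 < 1 / α := by positivity
    have hb : 3 / α + 4 / α ^ 2 ≤ 5 / 2 := by
      have : 3 / α + 4 / α ^ 2 = 3 * (1 / α) + 4 * (1 / α) ^ 2 := by ring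
      rw [this]
      nlinarith
    have := mul_le_mul_of_nonneg_left hb (sq_nonneg p)
    have := mul_le_mul_of_nonneg_left h1 h0.le
    nlinarith
  have hκ : ∀ κ : Sym2 V → Option V → Bool,
      |∑ σ, (∏ v, proposalWeight p q (σ v)) * g (hardUpdate G κ X σ) -
        ∑ σ, (∏ v, proposalWeight p q (σ v)) * g (hardUpdate G κ (Function.update X v b) σ)| ≤
        (1 - p * (1 - 2 / α) / 2) * L := by
    intro κ
    -- The coupling enters as a weight-preserving change of variables in the second sum.
    rw [← Equiv.sum_comp (swapProposals_involutive G κ X v (X v) b).toPerm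
      (fun σ => (∏ v, proposalWeight p q (σ v)) * g (hardUpdate G κ (Function.update X v b) σ))]
    simp only [Function.Involutive.coe_toPerm, prod_proposalWeight_swapProposals]
    rw [← sum_sub_distrib]
    refine (abs_sum_le_sum_abs _ _).trans ?_
    calc
      _ ≤ ∑ σ : V → Option (Fin q), (∏ v, proposalWeight p q (σ v)) *
          (L * disagreeBound G κ X v b σ) := by
        refine sum_le_sum fun σ _ => ?_
        have hw : 0 ≤ ∏ v, proposalWeight p q (σ v) :=
          prod_nonneg fun _ _ => proposalWeight_nonneg h0.le hp1 _
        rw [← mul_sub, abs_mul, abs_of_nonneg hw]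
        refine mul_le_mul_of_nonneg_left ((hg.abs_sub_le _ _).trans ?_) hw
        exact mul_le_mul_of_nonneg_left (hammingDist_hardUpdate_le G κ X v b σ) hL
      _ = proposalMean p (disagreeBound G κ X v b) * L := by
        simp only [proposalMean, LinearMap.coe_mk, AddHom.coe_mk, sum_mul]
        exact sum_congr rfl fun σ _ => by ring
      _ ≤ _ := mul_le_mul_of_nonneg_right
        ((proposalMean_disagreeBound_le G hα0 h0.le hq hΔ κ X v b).trans hrate) hL
  rw [transition_mulVec_eq_sum_flags G hq2, transition_mulVec_eq_sum_flags G hq2,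
    ← sum_sub_distrib]
  refine (abs_sum_le_sum_abs _ _).trans ?_
  calc
    _ ≤ ∑ κ, flagsWeight β κ * ((1 - p * (1 - 2 / α) / 2) * L) := by
      refine sum_le_sum fun κ _ => ?_
      rw [← mul_sub, abs_mul, abs_of_nonneg (flagsWeight_nonneg β κ)]
      exact mul_le_mul_of_nonneg_left (hκ κ) (flagsWeight_nonneg β κ)
    _ = _ := by rw [← sum_mul, sum_flagsWeight, one_mul]

end Coupling

end

end DistMH

/-! ### Mixing time -/

theorem mainTheorem7 (α : ℝ) (hα : 2 < α) :
    ∃ p₀ : ℝ, 0 < p₀ ∧ p₀ ≤ 1 ∧ ∀ p : ℝ, 0 < p → p ≤ p₀ →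
      ∃ C : ℝ, 0 < C ∧
        ∀ (V : Type*) [Fintype V] [DecidableEq V] (G : SimpleGraph V) [DecidableRel G.Adj]
          (q : ℕ) (β : ℝ≥0∞), α * (G.maxDegree : ℝ) ≤ (q : ℝ) →
        ∀ δ : ℝ, 0 < δ → δ < 1 →
        ∀ t : ℕ, C * Real.log ((Fintype.card V : ℝ) / δ) ≤ (t : ℝ) →
        ∀ X₀ : V → Fin q,
          DistMH.tvDist (((DistMH.pottsMRF V q β).transition G p ^ t) X₀)
            (DistMH.gibbs (DistMH.pottsHamiltonian G q) β) ≤ δ := by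
  have hα0 : 0 < α := by linarith
  have hε : 0 < 1 - 2 / α := by rw [sub_pos, div_lt_one hα0]; exact hα
  have hε1 : 1 - 2 / α ≤ 1 := by linarith [div_nonneg zero_le_two hα0.le]
  refine ⟨(1 - 2 / α) / 5, by positivity, by linarith, fun p hp0 hp => ?_⟩
  have hr : 0 < p * (1 - 2 / α) / 2 := by positivity
  have hr1 : p * (1 - 2 / α) / 2 ≤ 1 := by nlinarith
  refine ⟨(p * (1 - 2 / α) / 2)⁻¹, inv_pos.mpr hr, ?_⟩
  intro V _ _ G _ q β hΔ δ hδ hδ1 t ht X₀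
  rcases isEmpty_or_nonempty V with hV | hV
  · have hE : G.edgeFinset = ∅ := Finset.eq_empty_of_isEmpty _
    have hZ := DistMH.partitionFunction_pos (DistMH.pottsHamiltonian G q) β
      ⟨X₀, by simp [DistMH.pottsHamiltonian, hE]⟩
    -- Without vertices contraction is vacuous and the bound carries the factor `Fintype.card V =
    -- 0`, so any rate serves; here `q` may be 0.
    refine (DistMH.tvDist_pow_le (r := 0) le_rfl (fun L g _ X v => hV.elim v) _
      (fun X => div_nonneg (pow_nonneg (DistMH.boltzmann_nonneg β) _) hZ.le) ?_ ?_ t X₀).trans ?_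
    · simp only [← Finset.sum_div]
      exact div_self hZ.ne'
    · intro g
      simp only [div_mul_eq_mul_div, ← Finset.sum_div]
      rw [DistMH.sum_boltzmann_pow_mul_transition_mulVec G (Or.inl hV) (Or.inr hE)]
    · simpa using hδ.le
  · have hq : 0 < q := (X₀ (Classical.arbitrary V)).pos
    -- If there is an edge, then `q ≥ α > 2`.
    have hq2 : 2 ≤ q ∨ G.edgeFinset = ∅ := by
      rcases Nat.eq_zero_or_pos G.maxDegree with h | h
      · right
        rw [SimpleGraph.maxDegree_eq_zero_iff] at h
        simp [h]
      · left
        have : (1 : ℝ) ≤ G.maxDegree := by exact_mod_cast h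
        have : (2 : ℝ) ≤ q := by nlinarith
        exact_mod_cast this
    have hmax : G.maxDegree < q := by
      have h0 : (0 : ℝ) ≤ G.maxDegree := Nat.cast_nonneg _
      rcases Nat.eq_zero_or_pos G.maxDegree with h | h
      · omega
      · have : (1 : ℝ) ≤ G.maxDegree := by exact_mod_cast h
        have : (G.maxDegree : ℝ) < q := by nlinarith
        exact_mod_cast this
    have hZ := DistMH.partitionFunction_pos _ β (DistMH.exists_pottsHamiltonian_eq_zero G hmax)
    refine (DistMH.tvDist_pow_le (r := 1 - p * (1 - 2 / α) / 2) (by linarith)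
      (fun L g hg => hg.transition_mulVec G hα hp0 hp hq hq2 hΔ) _
      (fun X => div_nonneg (pow_nonneg (DistMH.boltzmann_nonneg β) _) hZ.le) ?_ ?_ t X₀).trans ?_
    · simp only [← Finset.sum_div]
      exact div_self hZ.ne'
    · intro g
      simp only [div_mul_eq_mul_div, ← Finset.sum_div]
      rw [DistMH.sum_boltzmann_pow_mul_transition_mulVec G (Or.inr hq) hq2]
    · have hn : (0 : ℝ) < Fintype.card V := by exact_mod_cast Fintype.card_pos
      rw [inv_mul_le_iff₀ hr] at ht
      have h1 : (1 - p * (1 - 2 / α) / 2) ^ t ≤ Real.exp (-(p * (1 - 2 / α) / 2 * t)) := by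
        refine (pow_le_pow_left₀ (by linarith)
          (Real.one_sub_le_exp_neg (p * (1 - 2 / α) / 2)) t).trans_eq ?_
        rw [← Real.exp_nat_mul]
        congr 1
        ring
      have h2 : Real.exp (-(p * (1 - 2 / α) / 2 * t)) ≤ δ / Fintype.card V := by
        rw [← Real.exp_log (div_pos hδ hn), Real.exp_le_exp, ← inv_div (Fintype.card V : ℝ) δ,
          Real.log_inv]
        linarith
      exact (mul_le_mul_of_nonneg_right (h1.trans h2) hn.le).trans_eq (by field_simp)
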